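/- Let $X,Y,Z$ be the Pauli matrices. Let $\mathcal P_n$ be the $n$-qubit Pauli group, $\mathcal C_n=\{C \text{ unitary} : C\mathcal P_nC^\dagger=\mathcal P_n\}$ the Clifford group, and $\mathfrak C_n=\{|\vec f\rangle : \vec f\in\mathbb F_2^n\}$ the computational basis of $n$ qubits (without phases). Let $\gamma_{2i}=Z_0\cdots Z_{i-1}X_i$ and $\gamma_{2i+1}=Z_0\cdots Z_{i-1}Y_i$ $(0\le i<n)$ be the Jordan--Wigner operators. For a unitary $U$, the fermion--qubit mapping $\mathfrak m_U=\big((U\gamma_{2i}U^\dagger,\,U\gamma_{2i+1}U^\dagger)\big)_{i=0}^{n-1}=\big((\Gamma_{2i},\Gamma_{2i+1})\big)_{i=0}^{n-1}$ has annihilation operators $A_i=\tfrac12(\Gamma_{2i}+\mathrm i\,\Gamma_{2i+1})$. A vacuum state $|\vec 0_{\mathfrak m}\rangle$ of $\mathfrak m=\mathfrak m_U$ is a unit vector annihilated by all $A_i^\dagger A_i$ (it is unique up to a phase). Once it is chosen, the Fock states are $|\vec f_{\mathfrak m}\rangle=(A_0^\dagger)^{f_0}\cdots(A_{n-1}^\dagger)^{f_{n-1}}|\vec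 0_{\mathfrak m}\rangle$. The mapping classically encodes the Fock basis if $|\vec f_{\mathfrak m}\rangle\in\mathfrak C_n$ for all $\vec f\in\mathbb F_2^n$, and it linearly encodes it if there is $G\in\mathrm{GL}_n(\mathbb F_2)$ with $|\vec f_{\mathfrak m}\rangle=|G\vec f\rangle$ for all $\vec f$. An $n$-vertex ternary tree $T$ is a rooted tree whose $n$ vertices are labelled bijectively by $0,\dots,n-1$ and in which each vertex has at most three children, placed at distinct positions among $X,Y,Z$; each empty position is filled with an unlabelled leaf. Each of the $2n+1$ root-to-leaf paths spells out a Pauli string in $\{\mathbb 1,X,Y,Z\}^{\otimes n}$: it acts on qubit $v$ by the letter of the edge by which the path leaves vertex $v$, and by $\mathbb 1$ if the path does not visit $v$. Let $\widetilde{\mathcal G}_T$ be the set of these strings. **Lemma.** Let $T$ be an $n$-vertex ternary tree. Then there is a Clifford operator $C_T\in\mathcal C_n$, unique up to a global phase, such that $\mathfrak m(T)=\mathfrak m_{C_T}$ has the following properties: 1. $\mathfrak m(T)$ is a $T$-based mapping, i.e. for each $0\le j<2n$ one of $\pm C_T\gamma_jC_T^\dagger$ lies in $\widetilde{\mathcal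 G}_T$; 2. $|0\cdots0\rangle$ is a vacuum state of $\mathfrak m(T)$, and with the choice $|\vec 0_{\mathfrak m(T)}\rangle=|0\cdots0\rangle$ the mapping $\mathfrak m(T)$ classically encodes the Fock basis. In particular the mapping $\mathfrak m(T)$ is unique, and $C_T$ itself is unique under the normalization $C_T|\vec f\rangle=|\vec f_{\mathfrak m(T)}\rangle$ for all $\vec f\in\mathbb F_2^n$, which fixes the phase. Moreover, for every $C\in\mathcal C_n$ such that $\mathfrak m_C$ satisfies property 2, the mapping $\mathfrak m_C$ linearly encodes the Fock basis with vacuum state $|0\cdots0\rangle$; in particular $\mathfrak m(T)$ does. -/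

import Mathlib

noncomputable section

/-! ## Qubits: computational basis, Pauli strings, Clifford operators -/

/-- Operators on `n` qubits, as matrices in the computational basis, which is indexed by the
bit-strings `Fin n → ZMod 2`. -/
abbrev QubitOp (n : ℕ) : Type := Matrix (Fin n → ZMod 2) (Fin n → ZMod 2) ℂ

/-- Vectors in the state space of `n` qubits. -/
abbrev QubitVec (n : ℕ) : Type := (Fin n → ZMod 2) → ℂ

/-- The computational basis state `|f⟩`. In particular `ket 0` is `|0…0⟩`. -/
def ket {n : ℕ} (f : Fin n → ZMod 2) : QubitVec n := Pi.single f 1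

/-- The computational basis, without phases. -/
def compBasis (n : ℕ) : Set (QubitVec n) := Set.range ket

/-- Labels of the four single-qubit Pauli matrices. -/
inductive Pauli : Type
  | I
  | X
  | Y
  | Z

/-- The single-qubit Pauli matrices. -/
def Pauli.toMatrix : Pauli → Matrix (ZMod 2) (ZMod 2) ℂ
  | .I => 1
  | .X => (!![0, 1; 1, 0] : Matrix (Fin 2) (Fin 2) ℂ)
  | .Y => (!![0, -Complex.I; Complex.I, 0] : Matrix (Fin 2) (Fin 2) ℂ)
  | .Z => (!![1, 0; 0, -1] : Matrix (Fin 2) (Fin 2) ℂ)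

/-- The unsigned Pauli string `p 0 ⊗ ⋯ ⊗ p (n-1)`: the entries of a tensor product of matrices are
the products of the entries of the factors. -/
def pauliString {n : ℕ} (p : Fin n → Pauli) : QubitOp n :=
  Matrix.of fun x y => ∏ j, (p j).toMatrix (x j) (y j)

/-- The `n`-qubit Pauli group: unsigned Pauli strings up to a factor `1, i, -1, -i`. -/
def pauliGroup (n : ℕ) : Set (QubitOp n) :=
  {P | ∃ (k : ℕ) (p : Fin n → Pauli), P = Complex.I ^ k • pauliString p}

/-- The `n`-qubit Clifford group: the unitaries `C` with `C 𝒫ₙ C† = 𝒫ₙ`. -/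
def cliffordGroup (n : ℕ) : Set (QubitOp n) :=
  {C | C ∈ Matrix.unitaryGroup (Fin n → ZMod 2) ℂ ∧
    (fun P => C * P * C.conjTranspose) '' pauliGroup n = pauliGroup n}

/-! ## Fermion-qubit mappings -/

/-- Jordan-Wigner: `γ_{2i} = Z_0 ⋯ Z_{i-1} X_i`. -/
def jwEven {n : ℕ} (i : Fin n) : QubitOp n :=
  pauliString fun k => if k < i then .Z else if k = i then .X else .I

/-- Jordan-Wigner: `γ_{2i+1} = Z_0 ⋯ Z_{i-1} Y_i`. -/
def jwOdd {n : ℕ} (i : Fin n) : QubitOp n :=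
  pauliString fun k => if k < i then .Z else if k = i then .Y else .I

/-- Ordered lists `((Γ_0, Γ_1), …, (Γ_{2n-2}, Γ_{2n-1}))` of `n` ordered pairs of `n`-qubit
operators. -/
abbrev OpPairs (n : ℕ) : Type := Fin n → QubitOp n × QubitOp n

/-- The list `((U γ_{2i} U†, U γ_{2i+1} U†))_i`. -/
def conjJW {n : ℕ} (U : QubitOp n) : OpPairs n :=
  fun i => (U * jwEven i * U.conjTranspose, U * jwOdd i * U.conjTranspose)

/-- An `n`-mode (ancilla-free) fermion-qubit mapping is a unitary conjugate of the Jordan-Wigner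
list. -/
def IsFermionQubitMapping {n : ℕ} (m : OpPairs n) : Prop :=
  ∃ U ∈ Matrix.unitaryGroup (Fin n → ZMod 2) ℂ, m = conjJW U

/-- The encoded annihilation operator `A_i = (Γ_{2i} + i Γ_{2i+1}) / 2`. -/
def annihilation {n : ℕ} (m : OpPairs n) (i : Fin n) : QubitOp n :=
  (1 / 2 : ℂ) • ((m i).1 + Complex.I • (m i).2)

/-- `ψ` is a vacuum state of `m`: a unit vector that is a simultaneous `0`-eigenvector of the number
operators `A_i† A_i`. It is determined by `m` up to a phase. -/
def IsVacuum {n : ℕ} (m : OpPairs n) (ψ : QubitVec n) : Prop :=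
  star ψ ⬝ᵥ ψ = 1 ∧
    ∀ i, ((annihilation m i).conjTranspose * annihilation m i).mulVec ψ = 0

/-- The Fock state `|f_m⟩ = (A_0†)^{f_0} (A_1†)^{f_1} ⋯ (A_{n-1}†)^{f_{n-1}} |0_m⟩` of `m`, when `ψ`
is chosen as the vacuum state `|0_m⟩`. -/
def fockState {n : ℕ} (m : OpPairs n) (ψ : QubitVec n) (f : Fin n → ZMod 2) : QubitVec n :=
  ((List.ofFn fun i => (annihilation m i).conjTranspose ^ (f i).val).prod).mulVec ψ

/-- `m`, with vacuum state `|0_m⟩ = ψ`, is a classical encoding of the Fock basis: every Fock state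
is a computational basis state (with phase `1`). -/
def IsClassicalEncoding {n : ℕ} (m : OpPairs n) (ψ : QubitVec n) : Prop :=
  IsFermionQubitMapping m ∧ IsVacuum m ψ ∧ ∀ f, fockState m ψ f ∈ compBasis n

/-- `m`, with vacuum state `|0_m⟩ = ψ`, is a linear encoding of the Fock basis: `|f_m⟩ = |G f⟩` for
an invertible binary matrix `G`. -/
def IsLinearEncoding {n : ℕ} (m : OpPairs n) (ψ : QubitVec n) : Prop :=
  IsFermionQubitMapping m ∧ IsVacuum m ψ ∧
    ∃ G : GL (Fin n) (ZMod 2), ∀ f, fockState m ψ f = ket (G.val.mulVec f)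

/-! ## Ternary trees -/

/-- Rooted trees in which each labelled vertex has three positions for its children, in the order
`X, Y, Z` from top to bottom. A position that holds no labelled vertex holds an unlabelled `leaf`. -/
inductive TernaryTree (α : Type) : Type
  | leaf : TernaryTree α
  | node (v : α) (x y z : TernaryTree α) : TernaryTree α

/-- The labels of the labelled vertices, with repetitions. -/
def TernaryTree.labels {α : Type} : TernaryTree α → List α
  | .leaf => []
  | .node v x y z => v :: (x.labels ++ y.labels ++ z.labels)

/-- `T` is an `n`-vertex ternary tree: each label in `{0, …, n-1}` occurs on exactly one vertex. -/
def TernaryTree.IsLabelled {n : ℕ} (T : TernaryTree (Fin n)) : Prop :=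
  T.labels.Nodup ∧ ∀ i, i ∈ T.labels

/-- The unsigned Pauli strings spelled out by the root-to-leaf paths of `T`: a path that leaves the
vertex `v` by the edge `X`, `Y` or `Z` has this letter on qubit `v`, and it has the identity on the
qubits that it does not visit. -/
def TernaryTree.pathStrings {n : ℕ} : TernaryTree (Fin n) → Set (Fin n → Pauli)
  | .leaf => {fun _ => .I}
  | .node v x y z =>
      (fun p => Function.update p v .X) '' x.pathStrings ∪
      (fun p => Function.update p v .Y) '' y.pathStrings ∪
      (fun p => Function.update p v .Z) '' z.pathStrings

/-- The `T`-based set of unsigned, anticommuting Pauli operators. -/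
def TernaryTree.paulis {n : ℕ} (T : TernaryTree (Fin n)) : Set (QubitOp n) :=
  pauliString '' T.pathStrings

/-- `m` is a `T`-based mapping: a fermion-qubit mapping all of whose operators are, up to sign,
in the `T`-based set. (Its `2n` operators anticommute, so they are distinct, even up to sign.) -/
def IsTreeBased {n : ℕ} (T : TernaryTree (Fin n)) (m : OpPairs n) : Prop :=
  IsFermionQubitMapping m ∧
    ∀ i, ((m i).1 ∈ T.paulis ∨ -(m i).1 ∈ T.paulis) ∧ ((m i).2 ∈ T.paulis ∨ -(m i).2 ∈ T.paulis)

end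

/-! Up to a phase, a Pauli string is `X^a Z^b` for two bit vectors: flips `a` and signs `b`.

Rigidity (`exists_eq_smul_linOp`): a Clifford operator `C` with property 2 sends `|f⟩` to a fixed
phase times `|σ f⟩`, with `σ 0 = 0`. Since `C X^g C†` is again a Pauli operator, `σ (f + g)` and `σ
f` differ by a vector independent of `f`. So `σ` is additive, hence a matrix `G`, and `C` is a phase
times `linOp G`. Conversely, every `linOp G` is Clifford and has property 2. It remains to show that
exactly one `G` is `T`-based.

Conjugation by `linOp G` acts on flips by `G` and on signs by the inverse transpose, so it preserves
the pairing (signs of `p`)·(flips of `q`). For the even Jordan-Wigner operators this pairing is 1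
exactly when the mode of `q` comes before that of `p`: it records the order of the modes.

In a tree, discard the all-`Z` path. The other path strings form `n` pairs with equal flips, and the
pairing orders these pairs linearly as Jordan-Wigner requires (`pathPairing`). The flips in this
order are the columns of a suitable `G` (`exists_isTreeBased`). Any other solution has to use the
same strings in the same order (`exists_ofFn_eq_of_isTreeBased`). -/

variable {n : ℕ}

/-! ### Pauli strings in the form `X^a Z^b`. -/

/-- The additive character of `ZMod 2` with values `1, -1`. -/
noncomputable def zmodSign (z : ZMod 2) : ℂ := if z = 0 then 1 else -1

@[simp] theorem zmodSign_zero : zmodSign 0 = 1 := by simp [zmodSign]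

@[simp] theorem zmodSign_one : zmodSign 1 = -1 := by simp [zmodSign]

theorem zmod_two_eq_zero_or_one (a : ZMod 2) : a = 0 ∨ a = 1 := by
  revert a; decide

theorem zmodSign_add (a b : ZMod 2) : zmodSign (a + b) = zmodSign a * zmodSign b := by
  have h : (1 : ZMod 2) + 1 = 0 := by decide
  rcases zmod_two_eq_zero_or_one a with rfl | rfl <;>
    rcases zmod_two_eq_zero_or_one b with rfl | rfl <;> simp [h]

theorem zmodSign_sum {ι : Type*} (s : Finset ι) (f : ι → ZMod 2) :
    zmodSign (∑ i ∈ s, f i) = ∏ i ∈ s, zmodSign (f i) := by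
  classical
  induction s using Finset.induction_on with
  | empty => simp
  | insert a s ha ih => rw [Finset.sum_insert ha, Finset.prod_insert ha, zmodSign_add, ih]

theorem zmodSign_eq_one_or (z : ZMod 2) : zmodSign z = 1 ∨ zmodSign z = -1 := by
  unfold zmodSign; split_ifs <;> simp

theorem zmodSign_injective : Function.Injective zmodSign := by
  intro a b h
  rcases zmod_two_eq_zero_or_one a with rfl | rfl <;>
    rcases zmod_two_eq_zero_or_one b with rfl | rfl <;>
    first | rfl | (norm_num [zmodSign] at h)

theorem ket_injective : Function.Injective (ket (n := n)) := by
  intro f g h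
  by_contra hne
  have := congrFun h f
  simp [ket, hne] at this

theorem eq_of_ket_eq_smul_ket {f g : Fin n → ZMod 2} {c : ℂ} (h : ket f = c • ket g) : f = g := by
  by_contra hne
  have := congrFun h f
  simp [ket, hne] at this

theorem ext_ket {A B : QubitOp n} (h : ∀ f, A.mulVec (ket f) = B.mulVec (ket f)) : A = B :=
  Matrix.ext_of_mulVec_single h

/-- The operator `X^a Z^b`, which maps `|f⟩` to `(-1)^{b·f} |f + a⟩`. -/
noncomputable def xzOp (a b : Fin n → ZMod 2) : QubitOp n :=
  Matrix.of fun x y => if x = y + a then zmodSign (b ⬝ᵥ y) else 0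

theorem xzOp_mulVec_ket (a b f : Fin n → ZMod 2) :
    (xzOp a b).mulVec (ket f) = zmodSign (b ⬝ᵥ f) • ket (f + a) := by
  ext x
  simp [xzOp, ket, Pi.single_apply]

/-- The bit that says whether a Pauli label flips its qubit. -/
def Pauli.xBit : Pauli → ZMod 2
  | .I => 0
  | .X => 1
  | .Y => 1
  | .Z => 0

/-- The bit that says whether a Pauli label applies a sign to its qubit. -/
def Pauli.zBit : Pauli → ZMod 2
  | .I => 0
  | .X => 0
  | .Y => 1
  | .Z => 1

theorem matrix_fin_two_apply_zmod (a b c d : ℂ) (s t : ZMod 2) :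
    (!![a, b; c, d] : Matrix (Fin 2) (Fin 2) ℂ) s t =
      if s = 0 then (if t = 0 then a else b) else (if t = 0 then c else d) := by
  rcases zmod_two_eq_zero_or_one s with rfl | rfl <;>
    rcases zmod_two_eq_zero_or_one t with rfl | rfl <;> rfl

theorem Pauli.toMatrix_apply (P : Pauli) (s t : ZMod 2) :
    P.toMatrix s t = if s = t + P.xBit then
      Complex.I ^ (P.xBit * P.zBit).val * zmodSign (P.zBit * t) else 0 := by
  have h : (1 : ZMod 2) + 1 = 0 := by decide
  have h1 : ZMod.val (1 : ZMod 2) = 1 := by decide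
  cases P <;> rcases zmod_two_eq_zero_or_one s with rfl | rfl <;>
    rcases zmod_two_eq_zero_or_one t with rfl | rfl <;>
    simp [Pauli.toMatrix, matrix_fin_two_apply_zmod, Pauli.xBit, Pauli.zBit, h, h1]

/-- The label with given flip and sign bits. -/
def Pauli.ofBits (a b : ZMod 2) : Pauli :=
  if a = 0 then (if b = 0 then .I else .Z) else (if b = 0 then .X else .Y)

theorem Pauli.xBit_ofBits (a b : ZMod 2) : (Pauli.ofBits a b).xBit = a := by
  fin_cases a <;> fin_cases b <;> rfl

theorem Pauli.zBit_ofBits (a b : ZMod 2) : (Pauli.ofBits a b).zBit = b := by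
  fin_cases a <;> fin_cases b <;> rfl

/-- The flip bits of a Pauli string. -/
def xBits (p : Fin n → Pauli) : Fin n → ZMod 2 := fun i => (p i).xBit

/-- The sign bits of a Pauli string. -/
def zBits (p : Fin n → Pauli) : Fin n → ZMod 2 := fun i => (p i).zBit

/-- The number of letters `Y` in a Pauli string. -/
def yCount (p : Fin n → Pauli) : ℕ := ∑ i, ((p i).xBit * (p i).zBit).val

theorem yCount_cast (p : Fin n → Pauli) : (yCount p : ZMod 2) = zBits p ⬝ᵥ xBits p := by
  simp [yCount, dotProduct, zBits, xBits, mul_comm]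

/-- Because `Y = i X Z`, each letter `Y` contributes one factor `i`. -/
theorem pauliString_eq (p : Fin n → Pauli) :
    pauliString p = Complex.I ^ yCount p • xzOp (xBits p) (zBits p) := by
  ext x y
  simp only [pauliString, Matrix.of_apply, Pauli.toMatrix_apply, xzOp, Matrix.smul_apply,
    smul_eq_mul, mul_ite, mul_zero]
  by_cases h : x = y + xBits p
  · rw [if_pos h, dotProduct, zmodSign_sum, yCount, ← Finset.prod_pow_eq_pow_sum,
      ← Finset.prod_mul_distrib]
    refine Finset.prod_congr rfl fun i _ => ?_
    rw [if_pos (by rw [h]; rfl)]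
    rfl
  · rw [if_neg h]
    obtain ⟨i, hi⟩ := Function.ne_iff.mp h
    exact Finset.prod_eq_zero (Finset.mem_univ i) (if_neg hi)

theorem pauliString_conjTranspose (p : Fin n → Pauli) :
    (pauliString p).conjTranspose = pauliString p := by
  have key : ∀ (P : Pauli) (s t : ZMod 2), star (P.toMatrix t s) = P.toMatrix s t := by
    intro P s t
    cases P <;> rcases zmod_two_eq_zero_or_one s with rfl | rfl <;>
      rcases zmod_two_eq_zero_or_one t with rfl | rfl <;> simp [Pauli.toMatrix, matrix_fin_two_apply_zmod]
  ext x y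
  simp only [pauliString, Matrix.conjTranspose_apply, Matrix.of_apply, star_prod, key]

theorem xzOp_smul_mem_pauliGroup (k : ℕ) (a b : Fin n → ZMod 2) :
    Complex.I ^ k • xzOp a b ∈ pauliGroup n := by
  set p : Fin n → Pauli := fun i => Pauli.ofBits (a i) (b i) with hp
  -- The string itself carries `i ^ yCount p`; the extra exponent `3 * yCount p` completes it to a
  -- power of `i ^ 4 = 1`.
  refine ⟨k + 3 * yCount p, p, ?_⟩
  have ha : xBits p = a := funext fun i => Pauli.xBit_ofBits _ _
  have hb : zBits p = b := funext fun i => Pauli.zBit_ofBits _ _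
  rw [pauliString_eq, ha, hb, smul_smul, ← pow_add,
    show k + 3 * yCount p + yCount p = k + 4 * yCount p by ring, pow_add, pow_mul,
    Complex.I_pow_four, one_pow, mul_one]

theorem mem_pauliGroup_iff {P : QubitOp n} :
    P ∈ pauliGroup n ↔ ∃ (k : ℕ) (a b : Fin n → ZMod 2), P = Complex.I ^ k • xzOp a b := by
  constructor
  · rintro ⟨k, p, rfl⟩
    exact ⟨k + yCount p, xBits p, zBits p, by rw [pauliString_eq, smul_smul, ← pow_add]⟩
  · rintro ⟨k, a, b, rfl⟩
    exact xzOp_smul_mem_pauliGroup k a b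

/-- The image of `|0⟩` reveals the flips and forces `c = 1`; the unit vectors then reveal the signs
one by one. -/
theorem xzOp_eq_smul_xzOp {a b a' b' : Fin n → ZMod 2} {c : ℂ}
    (h : xzOp a b = c • xzOp a' b') : a = a' ∧ b = b' := by
  have key : ∀ f, zmodSign (b ⬝ᵥ f) • ket (f + a) = (c * zmodSign (b' ⬝ᵥ f)) • ket (f + a') := by
    intro f
    rw [← xzOp_mulVec_ket, h, Matrix.smul_mulVec, xzOp_mulVec_ket, smul_smul]
  have ha : a = a' := by
    have h0 := key 0
    simp only [dotProduct_zero, zmodSign_zero, one_smul, zero_add] at h0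
    exact eq_of_ket_eq_smul_ket h0
  subst ha
  have key' : ∀ f, zmodSign (b ⬝ᵥ f) = c * zmodSign (b' ⬝ᵥ f) := by
    intro f
    have := congrFun (key f) (f + a)
    simpa [ket] using this
  have hc : c = 1 := by simpa using (key' 0).symm
  refine ⟨rfl, funext fun i => zmodSign_injective ?_⟩
  simpa [hc] using key' (Pi.single i 1)

/-! ### The Jordan-Wigner mapping and its Fock basis. -/

/-- The indicator of the modes before `i`. -/
def before (i : Fin n) : Fin n → ZMod 2 := fun k => if k < i then 1 else 0

/-- The Jordan-Wigner mapping. -/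
noncomputable def jordanWigner (n : ℕ) : OpPairs n := fun i => (jwEven i, jwOdd i)

theorem before_apply_self (i : Fin n) : before i i = 0 := by simp [before]

theorem jwEven_eq (i : Fin n) : jwEven i = xzOp (Pi.single i 1) (before i) := by
  have hx : xBits (fun k => if k < i then Pauli.Z else if k = i then .X else .I) =
      Pi.single i 1 := by
    ext k
    rcases lt_trichotomy k i with h | h | h
    · simp [xBits, Pauli.xBit, h, h.ne]
    · subst h; simp [xBits, Pauli.xBit]
    · simp [xBits, Pauli.xBit, h.not_gt, h.ne']
  have hz : zBits (fun k => if k < i then Pauli.Z else if k = i then .X else .I) = before i := by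
    ext k
    rcases lt_trichotomy k i with h | h | h
    · simp [zBits, Pauli.zBit, h, before]
    · subst h; simp [zBits, Pauli.zBit, before]
    · simp [zBits, Pauli.zBit, h.not_gt, h.ne', before]
  have hy : yCount (fun k => if k < i then Pauli.Z else if k = i then .X else .I) = 0 := by
    refine Finset.sum_eq_zero fun k _ => ?_
    dsimp only
    split_ifs <;> rfl
  rw [jwEven, pauliString_eq, hx, hz, hy, pow_zero, one_smul]

theorem jwOdd_eq (i : Fin n) :
    jwOdd i = Complex.I • xzOp (Pi.single i 1) (before i + Pi.single i 1) := by
  have hx : xBits (fun k => if k < i then Pauli.Z else if k = i then .Y else .I) =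
      Pi.single i 1 := by
    ext k
    rcases lt_trichotomy k i with h | h | h
    · simp [xBits, Pauli.xBit, h, h.ne]
    · subst h; simp [xBits, Pauli.xBit]
    · simp [xBits, Pauli.xBit, h.not_gt, h.ne']
  have hz : zBits (fun k => if k < i then Pauli.Z else if k = i then .Y else .I) =
      before i + Pi.single i 1 := by
    ext k
    rcases lt_trichotomy k i with h | h | h
    · simp [zBits, Pauli.zBit, h, before, h.ne]
    · subst h; simp [zBits, Pauli.zBit, before]
    · simp [zBits, Pauli.zBit, h.not_gt, h.ne', before]
  have hy : yCount (fun k => if k < i then Pauli.Z else if k = i then .Y else .I) = 1 := by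
    rw [yCount, Finset.sum_eq_single i]
    · simp only [lt_irrefl, if_false, if_true]; rfl
    · intro k _ hk
      rw [if_neg hk]
      split_ifs <;> rfl
    · simp
  rw [jwOdd, pauliString_eq, hx, hz, hy, pow_one]

theorem jordanWigner_annihilation_mulVec_ket (i : Fin n) (f : Fin n → ZMod 2) :
    (annihilation (jordanWigner n) i).mulVec (ket f) =
      if f i = 0 then 0 else zmodSign (before i ⬝ᵥ f) • ket (f + Pi.single i 1) := by
  simp only [annihilation, jordanWigner, jwEven_eq, jwOdd_eq, Matrix.smul_mulVec,
    Matrix.add_mulVec, xzOp_mulVec_ket, add_dotProduct, zmodSign_add, single_dotProduct, one_mul,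
    smul_smul, ← add_smul]
  rcases zmod_two_eq_zero_or_one (f i) with h | h
  · rw [if_pos h, h, zmodSign_zero, mul_one, Complex.I_mul_I]
    simp
  · rw [if_neg (by rw [h]; decide), h, zmodSign_one, Complex.I_mul_I]
    congr 1
    ring

theorem jordanWigner_creation_mulVec_ket (i : Fin n) (f : Fin n → ZMod 2) :
    (annihilation (jordanWigner n) i).conjTranspose.mulVec (ket f) =
      if f i = 0 then zmodSign (before i ⬝ᵥ f) • ket (f + Pi.single i 1) else 0 := by
  have h1 : (jwEven i).conjTranspose = jwEven i := pauliString_conjTranspose _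
  have h2 : (jwOdd i).conjTranspose = jwOdd i := pauliString_conjTranspose _
  simp only [annihilation, jordanWigner, Matrix.conjTranspose_smul, Matrix.conjTranspose_add, h1,
    h2]
  simp only [jwEven_eq,
    jwOdd_eq, Matrix.smul_mulVec, Matrix.add_mulVec, xzOp_mulVec_ket,
    add_dotProduct, zmodSign_add, single_dotProduct, one_mul, smul_smul, ← add_smul]
  rcases zmod_two_eq_zero_or_one (f i) with h | h
  · rw [if_pos h, h, zmodSign_zero, mul_one]
    congr 1
    simp
    ring
  · rw [if_neg (by rw [h]; decide), h, zmodSign_one]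
    simp

theorem jordanWigner_number_mulVec_ket (i : Fin n) (f : Fin n → ZMod 2) :
    ((annihilation (jordanWigner n) i).conjTranspose * annihilation (jordanWigner n) i).mulVec
      (ket f) = if f i = 0 then 0 else ket f := by
  have h2 : (1 : ZMod 2) + 1 = 0 := by decide
  rw [← Matrix.mulVec_mulVec, jordanWigner_annihilation_mulVec_ket]
  rcases zmod_two_eq_zero_or_one (f i) with h | h
  · simp [h]
  · rw [if_neg (by rw [h]; decide), if_neg (by rw [h]; decide), Matrix.mulVec_smul,
      jordanWigner_creation_mulVec_ket, if_pos (by simp [h, h2]), dotProduct_add,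
      dotProduct_single, before_apply_self, zero_mul, add_zero, smul_smul, add_assoc,
      ← Pi.single_add, h2]
    rcases zmodSign_eq_one_or (before i ⬝ᵥ f) with e | e <;> simp [e]

/-- The diagonal form gives the coordinates of the image of an arbitrary vector, as needed for an
unknown vacuum. -/
theorem jordanWigner_number_eq_diagonal (i : Fin n) :
    (annihilation (jordanWigner n) i).conjTranspose * annihilation (jordanWigner n) i =
      Matrix.diagonal fun f => if f i = 0 then 0 else 1 := by
  refine ext_ket fun f => ?_
  rw [jordanWigner_number_mulVec_ket]
  ext g
  rw [Matrix.mulVec_diagonal]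
  by_cases hg : g = f
  · subst hg; split_ifs <;> simp
  · split_ifs <;> simp [ket, hg]

/-- The rightmost factor, belonging to the largest mode, acts first. When mode `i` is filled, only
later modes are occupied, so the sign counting occupied modes before `i` is trivial. -/
theorem prod_creation_mulVec_ket_zero (f : Fin n → ZMod 2) (l : List (Fin n))
    (hl : l.Pairwise (· < ·)) :
    ((l.map fun i => (annihilation (jordanWigner n) i).conjTranspose ^ (f i).val).prod).mulVec
      (ket 0) = ket fun i => if i ∈ l then f i else 0 := by
  induction l with
  | nil => simp; rfl
  | cons i l ih =>
    rw [List.pairwise_cons] at hl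
    rw [List.map_cons, List.prod_cons, ← Matrix.mulVec_mulVec, ih hl.2]
    have hil : i ∉ l := fun h => (hl.1 i h).false
    rcases zmod_two_eq_zero_or_one (f i) with h | h
    · rw [h, ZMod.val_zero, pow_zero, Matrix.one_mulVec]
      congr 1
      ext k
      by_cases hk : k = i
      · subst hk; simp [hil, h]
      · simp [hk]
    · rw [h, ZMod.val_one, pow_one, jordanWigner_creation_mulVec_ket, if_pos (by simp [hil])]
      have hb : (before i ⬝ᵥ fun k => if k ∈ l then f k else 0) = 0 := by
        refine Finset.sum_eq_zero fun k _ => ?_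
        by_cases hk : k ∈ l
        · simp [before, (hl.1 k hk).not_gt]
        · simp [hk]
      rw [hb, zmodSign_zero, one_smul]
      congr 1
      ext k
      by_cases hk : k = i
      · subst hk; simp [hil, h]
      · simp [hk]

theorem fockState_jordanWigner (f : Fin n → ZMod 2) :
    fockState (jordanWigner n) (ket 0) f = ket f := by
  rw [fockState, List.ofFn_eq_map,
    prod_creation_mulVec_ket_zero f _ (List.pairwise_lt_finRange n)]
  simp

/-! ### Transport along a unitary conjugation. -/

section Conjugation

variable {C : QubitOp n}

theorem conj_mul_conj (hC : C.conjTranspose * C = 1) (A B : QubitOp n) :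
    (C * A * C.conjTranspose) * (C * B * C.conjTranspose) = C * (A * B) * C.conjTranspose := by
  calc _ = C * A * (C.conjTranspose * C) * B * C.conjTranspose := by simp only [mul_assoc]
    _ = _ := by rw [hC, mul_one]; simp only [mul_assoc]

theorem pow_conj_conjTranspose (hC : C.conjTranspose * C = 1) (hC' : C * C.conjTranspose = 1) (A : QubitOp n)
    (k : ℕ) : (C * A * C.conjTranspose) ^ k = C * A ^ k * C.conjTranspose := by
  induction k with
  | zero => simp [hC']
  | succ k ih => rw [pow_succ, ih, conj_mul_conj hC, ← pow_succ]

theorem prod_map_conj {ι : Type*} (hC : C.conjTranspose * C = 1)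
    (hC' : C * C.conjTranspose = 1) (A : ι → QubitOp n) (l : List ι) :
    (l.map fun i => C * A i * C.conjTranspose).prod =
      C * (l.map A).prod * C.conjTranspose := by
  induction l with
  | nil => simp [hC']
  | cons i l ih => rw [List.map_cons, List.prod_cons, ih, conj_mul_conj hC, List.map_cons,
      List.prod_cons]

theorem annihilation_conjJW (C : QubitOp n) (i : Fin n) :
    annihilation (conjJW C) i = C * annihilation (jordanWigner n) i * C.conjTranspose := by
  simp only [annihilation, conjJW, jordanWigner, Matrix.mul_smul, Matrix.smul_mul, mul_add,
    add_mul]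

theorem creation_conjJW (C : QubitOp n) (i : Fin n) :
    (annihilation (conjJW C) i).conjTranspose =
      C * (annihilation (jordanWigner n) i).conjTranspose * C.conjTranspose := by
  rw [annihilation_conjJW, Matrix.conjTranspose_mul, Matrix.conjTranspose_mul,
    Matrix.conjTranspose_conjTranspose, mul_assoc]

theorem fockState_conjJW (hC : C.conjTranspose * C = 1) (hC' : C * C.conjTranspose = 1)
    (ψ : QubitVec n) (f : Fin n → ZMod 2) :
    fockState (conjJW C) ψ f =
      C.mulVec (fockState (jordanWigner n) (C.conjTranspose.mulVec ψ) f) := by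
  simp only [fockState, List.ofFn_eq_map, creation_conjJW, pow_conj_conjTranspose hC hC',
    prod_map_conj hC hC', Matrix.mulVec_mulVec]
  rw [mul_assoc]

theorem fockState_smul (m : OpPairs n) (c : ℂ) (ψ : QubitVec n) (f : Fin n → ZMod 2) :
    fockState m (c • ψ) f = c • fockState m ψ f :=
  Matrix.mulVec_smul _ _ _

/-- Pulled back by `C`, the vacuum is killed by every Jordan-Wigner number operator. These are
diagonal and the `i`-th one fixes each `|f⟩` with `f i = 1`, so only the coordinate at `0` survives.
-/
theorem conjTranspose_mulVec_vacuum (hC : C.conjTranspose * C = 1)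
    {ψ : QubitVec n} (h : IsVacuum (conjJW C) ψ) :
    ∃ c : ℂ, C.conjTranspose.mulVec ψ = c • ket 0 := by
  set φ := C.conjTranspose.mulVec ψ with hφ
  refine ⟨φ 0, ?_⟩
  have key : ∀ i, ((annihilation (jordanWigner n) i).conjTranspose *
      annihilation (jordanWigner n) i).mulVec φ = 0 := by
    intro i
    have := congrArg C.conjTranspose.mulVec (h.2 i)
    rw [creation_conjJW, annihilation_conjJW, conj_mul_conj hC, Matrix.mulVec_zero,
      Matrix.mulVec_mulVec, mul_assoc, ← mul_assoc C.conjTranspose, hC, one_mul,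
      ← Matrix.mulVec_mulVec] at this
    exact this
  ext f
  by_cases hf : f = 0
  · subst hf; simp [ket]
  · obtain ⟨i, hi⟩ := Function.ne_iff.mp hf
    have := congrFun (key i) f
    rw [jordanWigner_number_eq_diagonal, Matrix.mulVec_diagonal, if_neg (by exact hi), one_mul] at this
    simp [this, ket, hf]

end Conjugation

/-! ### Linear permutations of the basis as Clifford operators. -/

/-- The permutation `|f⟩ ↦ |G f⟩` of the computational basis. -/
noncomputable def linOp (G : GL (Fin n) (ZMod 2)) : QubitOp n :=
  Matrix.of fun x y => if x = G.val.mulVec y then 1 else 0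

theorem linOp_mulVec_ket (G : GL (Fin n) (ZMod 2)) (f : Fin n → ZMod 2) :
    (linOp G).mulVec (ket f) = ket (G.val.mulVec f) := by
  ext x
  simp [linOp, ket, Pi.single_apply]

theorem inv_mulVec_mulVec (G : GL (Fin n) (ZMod 2)) (f : Fin n → ZMod 2) :
    (G⁻¹).val.mulVec (G.val.mulVec f) = f := by
  rw [Matrix.mulVec_mulVec, Units.inv_mul, Matrix.one_mulVec]

theorem mulVec_inv_mulVec (G : GL (Fin n) (ZMod 2)) (f : Fin n → ZMod 2) :
    G.val.mulVec ((G⁻¹).val.mulVec f) = f := by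
  rw [Matrix.mulVec_mulVec, Units.mul_inv, Matrix.one_mulVec]

theorem linOp_conjTranspose (G : GL (Fin n) (ZMod 2)) :
    (linOp G).conjTranspose = linOp G⁻¹ := by
  ext x y
  have h : y = G.val.mulVec x ↔ x = (G⁻¹).val.mulVec y :=
    ⟨fun h => by rw [h, inv_mulVec_mulVec], fun h => by rw [h, mulVec_inv_mulVec]⟩
  simp [linOp, h, apply_ite]

theorem linOp_mul_linOp_inv (G : GL (Fin n) (ZMod 2)) : linOp G * linOp G⁻¹ = 1 := by
  refine ext_ket fun f => ?_
  rw [← Matrix.mulVec_mulVec, linOp_mulVec_ket, linOp_mulVec_ket, mulVec_inv_mulVec,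
    Matrix.one_mulVec]

theorem linOp_conjTranspose_mul_self (G : GL (Fin n) (ZMod 2)) :
    (linOp G).conjTranspose * linOp G = 1 := by
  rw [linOp_conjTranspose]
  simpa using linOp_mul_linOp_inv G⁻¹

theorem linOp_mul_conjTranspose_self (G : GL (Fin n) (ZMod 2)) :
    linOp G * (linOp G).conjTranspose = 1 := by
  rw [linOp_conjTranspose, linOp_mul_linOp_inv]

theorem linOp_mem_unitaryGroup (G : GL (Fin n) (ZMod 2)) :
    linOp G ∈ Matrix.unitaryGroup (Fin n → ZMod 2) ℂ :=
  Matrix.mem_unitaryGroup_iff.mpr (linOp_mul_conjTranspose_self G)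

theorem linOp_conj_xzOp (G : GL (Fin n) (ZMod 2)) (a b : Fin n → ZMod 2) :
    linOp G * xzOp a b * (linOp G).conjTranspose =
      xzOp (G.val.mulVec a) (Matrix.vecMul b (G⁻¹).val) := by
  refine ext_ket fun f => ?_
  rw [linOp_conjTranspose, ← Matrix.mulVec_mulVec, ← Matrix.mulVec_mulVec, linOp_mulVec_ket,
    xzOp_mulVec_ket, Matrix.mulVec_smul, linOp_mulVec_ket, xzOp_mulVec_ket, Matrix.mulVec_add,
    mulVec_inv_mulVec, Matrix.dotProduct_mulVec]

theorem linOp_conj_mem_pauliGroup (G : GL (Fin n) (ZMod 2)) {P : QubitOp n}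
    (hP : P ∈ pauliGroup n) : linOp G * P * (linOp G).conjTranspose ∈ pauliGroup n := by
  obtain ⟨k, a, b, rfl⟩ := mem_pauliGroup_iff.mp hP
  rw [Matrix.mul_smul, Matrix.smul_mul, linOp_conj_xzOp]
  exact xzOp_smul_mem_pauliGroup _ _ _

theorem linOp_mem_cliffordGroup (G : GL (Fin n) (ZMod 2)) : linOp G ∈ cliffordGroup n := by
  refine ⟨linOp_mem_unitaryGroup G, Set.Subset.antisymm ?_ fun P hP => ?_⟩
  · rintro _ ⟨P, hP, rfl⟩
    exact linOp_conj_mem_pauliGroup G hP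
  · refine ⟨_, linOp_conj_mem_pauliGroup G⁻¹ hP, ?_⟩
    have h1 := linOp_mul_linOp_inv G
    have h2 : linOp G⁻¹ * linOp G = 1 := by simpa using linOp_mul_linOp_inv G⁻¹
    simp only [linOp_conjTranspose, inv_inv]
    calc _ = (linOp G * linOp G⁻¹) * P * (linOp G * linOp G⁻¹) := by simp only [mul_assoc]
      _ = P := by rw [h1, one_mul, mul_one]

theorem fockState_conjJW_linOp (G : GL (Fin n) (ZMod 2)) (f : Fin n → ZMod 2) :
    fockState (conjJW (linOp G)) (ket 0) f = ket (G.val.mulVec f) := by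
  rw [fockState_conjJW (linOp_conjTranspose_mul_self G) (linOp_mul_conjTranspose_self G),
    linOp_conjTranspose, linOp_mulVec_ket, Matrix.mulVec_zero, fockState_jordanWigner,
    linOp_mulVec_ket]

theorem star_ket_dotProduct_ket (f : Fin n → ZMod 2) : star (ket f) ⬝ᵥ ket f = 1 := by
  simp [ket, dotProduct_single]

theorem isClassicalEncoding_conjJW_linOp (G : GL (Fin n) (ZMod 2)) :
    IsClassicalEncoding (conjJW (linOp G)) (ket 0) := by
  refine ⟨⟨_, linOp_mem_unitaryGroup G, rfl⟩, ⟨star_ket_dotProduct_ket 0, fun i => ?_⟩,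
    fun f => ⟨_, (fockState_conjJW_linOp G f).symm⟩⟩
  rw [creation_conjJW, annihilation_conjJW, conj_mul_conj (linOp_conjTranspose_mul_self G),
    ← Matrix.mulVec_mulVec, linOp_conjTranspose, linOp_mulVec_ket, Matrix.mulVec_zero,
    ← Matrix.mulVec_mulVec, jordanWigner_number_mulVec_ket]
  simp

/-! ### Clifford operators that encode the Fock basis classically. -/

theorem conjJW_smul {u : ℂ} (hu : ‖u‖ = 1) (C : QubitOp n) : conjJW (u • C) = conjJW C := by
  have h : star u * u = 1 := by
    rw [Complex.star_def, mul_comm, Complex.mul_conj, Complex.normSq_eq_norm_sq, hu]; simp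
  funext i
  simp only [conjJW, Matrix.conjTranspose_smul, Matrix.smul_mul, Matrix.mul_smul, smul_smul, h,
    one_smul]

/-- Classicality makes `C` a basis permutation up to one common phase; being Clifford makes the
permutation linear. -/
theorem exists_eq_smul_linOp {C : QubitOp n} (hC : C ∈ cliffordGroup n)
    (h : IsClassicalEncoding (conjJW C) (ket 0)) :
    ∃ (G : GL (Fin n) (ZMod 2)) (u : ℂ), ‖u‖ = 1 ∧ C = u • linOp G ∧
      ∀ f, fockState (conjJW C) (ket 0) f = ket (G.val.mulVec f) := by
  obtain ⟨hU, hP⟩ := hC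
  have h1 : C.conjTranspose * C = 1 := Matrix.mem_unitaryGroup_iff'.mp hU
  have h2 : C * C.conjTranspose = 1 := Matrix.mem_unitaryGroup_iff.mp hU
  obtain ⟨-, hvac, hf⟩ := h
  obtain ⟨c, hc⟩ := conjTranspose_mulVec_vacuum h1 hvac
  have fock : ∀ f, fockState (conjJW C) (ket 0) f = c • C.mulVec (ket f) := by
    intro f
    rw [fockState_conjJW h1 h2, hc, fockState_smul, fockState_jordanWigner, Matrix.mulVec_smul]
  choose σ hσ using hf
  have hσ' : ∀ f, c • C.mulVec (ket f) = ket (σ f) := fun f => by rw [← fock, hσ]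
  have hcn : ‖c‖ = 1 := by
    have e : star (C.conjTranspose.mulVec (ket 0)) ⬝ᵥ C.conjTranspose.mulVec (ket 0) = 1 := by
      rw [Matrix.star_mulVec, Matrix.conjTranspose_conjTranspose, ← Matrix.dotProduct_mulVec,
        Matrix.mulVec_mulVec, h2, Matrix.one_mulVec, star_ket_dotProduct_ket]
    rw [hc, star_smul, smul_dotProduct, dotProduct_smul, star_ket_dotProduct_ket, smul_eq_mul,
      smul_eq_mul, mul_one, Complex.star_def, mul_comm, Complex.mul_conj,
      Complex.normSq_eq_norm_sq] at e
    have e' : ‖c‖ ^ 2 = 1 := by exact_mod_cast e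
    nlinarith [norm_nonneg c]
  have hc0 : c ≠ 0 := fun h0 => by simp [h0] at hcn
  have hC : ∀ f, C.mulVec (ket f) = c⁻¹ • ket (σ f) := fun f => by
    rw [← hσ', smul_smul, inv_mul_cancel₀ hc0, one_smul]
  -- Here `c C|0⟩ = C C†|0⟩ = |0⟩`, by the choice of `c`.
  have hσ0 : σ 0 = 0 := by
    apply ket_injective
    rw [← hσ', ← Matrix.mulVec_smul, ← hc, Matrix.mulVec_mulVec, h2, Matrix.one_mulVec]
  have hinj : Function.Injective σ := by
    intro f g hfg
    have e : C.mulVec (ket f) = C.mulVec (ket g) := by rw [hC, hC, hfg]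
    have := congrArg C.conjTranspose.mulVec e
    rw [Matrix.mulVec_mulVec, Matrix.mulVec_mulVec, h1, Matrix.one_mulVec,
      Matrix.one_mulVec] at this
    exact ket_injective this
  -- The vector `a` consists of the flips of the Pauli operator `C X^g C†`, so it does not depend on
  -- `f`.
  have hshift : ∀ g, ∃ a, ∀ f, σ (f + g) = σ f + a := by
    intro g
    have hmem : C * xzOp g 0 * C.conjTranspose ∈ pauliGroup n := by
      rw [← hP]
      exact ⟨_, by simpa using xzOp_smul_mem_pauliGroup 0 g 0, rfl⟩
    obtain ⟨k, a, b, hab⟩ := mem_pauliGroup_iff.mp hmem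
    refine ⟨a, fun f => ?_⟩
    have e : C * xzOp g 0 = (Complex.I ^ k • xzOp a b) * C := by
      rw [← hab, mul_assoc _ _ C, h1, mul_one]
    have e' := congrArg (fun A => c • A.mulVec (ket f)) e
    simp only [← Matrix.mulVec_mulVec, xzOp_mulVec_ket, zero_dotProduct, zmodSign_zero, one_smul,
      Matrix.smul_mulVec, hσ', hC f, Matrix.mulVec_smul, smul_smul] at e'
    exact eq_of_ket_eq_smul_ket e'
  have hadd : ∀ f g, σ (f + g) = σ f + σ g := by
    intro f g
    obtain ⟨a, ha⟩ := hshift g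
    have h0 := ha 0
    rw [zero_add, hσ0, zero_add] at h0
    rw [ha f, h0]
  let s : (Fin n → ZMod 2) →ₗ[ZMod 2] (Fin n → ZMod 2) :=
    AddMonoidHom.toZModLinearMap 2 (AddMonoidHom.mk' σ hadd)
  have hs : ∀ f, (LinearMap.toMatrix' s).mulVec f = σ f := fun f =>
    LinearMap.toMatrix'_mulVec s f
  have hunit : IsUnit (LinearMap.toMatrix' s) := by
    rw [← Matrix.mulVec_injective_iff_isUnit]
    intro f g hfg
    exact hinj (by rw [← hs, ← hs]; exact hfg)
  obtain ⟨G, hG⟩ := hunit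
  refine ⟨G, c⁻¹, by rw [norm_inv, hcn, inv_one], ext_ket fun f => ?_, fun f => ?_⟩
  · rw [Matrix.smul_mulVec, linOp_mulVec_ket, hC, hG, hs]
  · rw [← hσ f, hG, hs]

theorem conjJW_linOp (G : GL (Fin n) (ZMod 2)) (i : Fin n) :
    conjJW (linOp G) i =
      (xzOp (G.val.mulVec (Pi.single i 1)) (Matrix.vecMul (before i) (G⁻¹).val),
        Complex.I • xzOp (G.val.mulVec (Pi.single i 1))
          (Matrix.vecMul (before i + Pi.single i 1) (G⁻¹).val)) := by
  simp only [conjJW, jwEven_eq, jwOdd_eq, Matrix.mul_smul, Matrix.smul_mul, linOp_conj_xzOp]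

/-! ### Path strings of a tree and their pairing. -/

theorem xBits_update (p : Fin n → Pauli) (v : Fin n) (P : Pauli) :
    xBits (Function.update p v P) = Function.update (xBits p) v P.xBit := by
  ext i
  by_cases h : i = v
  · subst h; simp [xBits]
  · simp [xBits, h]

theorem zBits_update (p : Fin n → Pauli) (v : Fin n) (P : Pauli) :
    zBits (Function.update p v P) = Function.update (zBits p) v P.zBit := by
  ext i
  by_cases h : i = v
  · subst h; simp [zBits]
  · simp [zBits, h]

/-- The pairing of the sign bits of one Pauli string with the flip bits of another. -/
def bitPairing (p q : Fin n → Pauli) : ZMod 2 := zBits p ⬝ᵥ xBits q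

/-- This drives the induction on trees: prefixing both strings by `X`, or both by `Z`, preserves the
pairing, while prefixing both by `Y` adds 1. -/
theorem bitPairing_update {p q : Fin n → Pauli} {v : Fin n} (hp : p v = .I) (P Q : Pauli) :
    bitPairing (Function.update p v P) (Function.update q v Q) =
      P.zBit * Q.xBit + bitPairing p q := by
  rw [bitPairing, bitPairing, zBits_update, xBits_update, dotProduct, dotProduct,
    ← Finset.add_sum_erase _ _ (Finset.mem_univ v), ← Finset.add_sum_erase _ _ (Finset.mem_univ v)]
  have h0 : zBits p v = 0 := by simp [zBits, hp, Pauli.zBit]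
  rw [h0, zero_mul, zero_add, Function.update_self, Function.update_self]
  congr 1
  refine Finset.sum_congr rfl fun i hi => ?_
  rw [Function.update_of_ne (Finset.ne_of_mem_erase hi),
    Function.update_of_ne (Finset.ne_of_mem_erase hi)]

theorem bitPairing_eq_zero {p q : Fin n → Pauli} (h : ∀ i, p i = .I ∨ q i = .I) :
    bitPairing p q = 0 := by
  rw [bitPairing, dotProduct]
  refine Finset.sum_eq_zero fun i _ => ?_
  rcases h i with h | h <;> simp [zBits, xBits, h, Pauli.zBit, Pauli.xBit]

namespace TernaryTree

/-- The string of the path that always takes the edge `Z`. -/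
def zPath : TernaryTree (Fin n) → Fin n → Pauli
  | .leaf => fun _ => .I
  | .node v _ _ z => Function.update z.zPath v .Z

/-- The remaining path strings, in pairs that differ by `Z`s, where the first string of each pair
has an even and the second one an odd number of letters `Y`. -/
def pathPairs : TernaryTree (Fin n) → List ((Fin n → Pauli) × (Fin n → Pauli))
  | .leaf => []
  | .node v x y z =>
      x.pathPairs.map (fun P => (Function.update P.1 v .X, Function.update P.2 v .X)) ++
      ((Function.update x.zPath v .X, Function.update y.zPath v .Y) ::
      -- A common edge `Y` adds 1 to every pairing. This reverses the order of the modes and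
      -- exchanges even and odd numbers of `Y`, whence the reversal and the swap.
      (y.pathPairs.reverse.map
        (fun P => (Function.update P.2 v .Y, Function.update P.1 v .Y)) ++
      z.pathPairs.map (fun P => (Function.update P.1 v .Z, Function.update P.2 v .Z))))

theorem length_pathPairs (T : TernaryTree (Fin n)) : T.pathPairs.length = T.labels.length := by
  induction T with
  | leaf => rfl
  | node v x y z hx hy hz => simp [pathPairs, labels, hx, hy, hz]; ring

theorem eq_I_of_mem_pathStrings {T : TernaryTree (Fin n)} {p : Fin n → Pauli}
    (hp : p ∈ T.pathStrings) {i : Fin n} (hi : i ∉ T.labels) : p i = .I := by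
  induction T generalizing p with
  | leaf => rw [show p = fun _ => .I from hp]
  | node v x y z hx hy hz =>
    simp only [labels, List.mem_cons, List.mem_append, not_or] at hi
    obtain ⟨hv, ⟨hix, hiy⟩, hiz⟩ := hi
    rcases hp with (⟨q, hq, rfl⟩ | ⟨q, hq, rfl⟩) | ⟨q, hq, rfl⟩
    · exact (Function.update_of_ne hv _ _).trans (hx hq hix)
    · exact (Function.update_of_ne hv _ _).trans (hy hq hiy)
    · exact (Function.update_of_ne hv _ _).trans (hz hq hiz)

theorem zPath_mem_pathStrings (T : TernaryTree (Fin n)) : T.zPath ∈ T.pathStrings := by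
  induction T with
  | leaf => rfl
  | node v x y z hx hy hz => exact Or.inr ⟨_, hz, rfl⟩

theorem mem_pathStrings_of_mem_pathPairs {T : TernaryTree (Fin n)}
    {P : (Fin n → Pauli) × (Fin n → Pauli)} (hP : P ∈ T.pathPairs) :
    P.1 ∈ T.pathStrings ∧ P.2 ∈ T.pathStrings := by
  induction T generalizing P with
  | leaf => simp [pathPairs] at hP
  | node v x y z hx hy hz =>
    simp only [pathPairs, List.mem_append, List.mem_cons, List.mem_map, List.mem_reverse] at hP
    rcases hP with ⟨Q, hQ, rfl⟩ | rfl | ⟨Q, hQ, rfl⟩ | ⟨Q, hQ, rfl⟩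
    · exact ⟨Or.inl (Or.inl ⟨_, (hx hQ).1, rfl⟩), Or.inl (Or.inl ⟨_, (hx hQ).2, rfl⟩)⟩
    · exact ⟨Or.inl (Or.inl ⟨_, x.zPath_mem_pathStrings, rfl⟩),
        Or.inl (Or.inr ⟨_, y.zPath_mem_pathStrings, rfl⟩)⟩
    · exact ⟨Or.inl (Or.inr ⟨_, (hy hQ).2, rfl⟩), Or.inl (Or.inr ⟨_, (hy hQ).1, rfl⟩)⟩
    · exact ⟨Or.inr ⟨_, (hz hQ).1, rfl⟩, Or.inr ⟨_, (hz hQ).2, rfl⟩⟩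

theorem eq_of_mem_pathStrings {T : TernaryTree (Fin n)} {p : Fin n → Pauli}
    (hp : p ∈ T.pathStrings) : p = T.zPath ∨ ∃ P ∈ T.pathPairs, p = P.1 ∨ p = P.2 := by
  induction T generalizing p with
  | leaf => exact Or.inl hp
  | node v x y z hx hy hz =>
    simp only [pathPairs, List.mem_append, List.mem_cons, List.mem_map, List.mem_reverse, zPath]
    rcases hp with (⟨q, hq, rfl⟩ | ⟨q, hq, rfl⟩) | ⟨q, hq, rfl⟩
    · right
      rcases hx hq with rfl | ⟨P, hP, rfl | rfl⟩
      · exact ⟨_, Or.inr (Or.inl rfl), Or.inl rfl⟩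
      · exact ⟨_, Or.inl ⟨P, hP, rfl⟩, Or.inl rfl⟩
      · exact ⟨_, Or.inl ⟨P, hP, rfl⟩, Or.inr rfl⟩
    · right
      rcases hy hq with rfl | ⟨P, hP, rfl | rfl⟩
      · exact ⟨_, Or.inr (Or.inl rfl), Or.inr rfl⟩
      · exact ⟨_, Or.inr (Or.inr (Or.inl ⟨P, hP, rfl⟩)), Or.inr rfl⟩
      · exact ⟨_, Or.inr (Or.inr (Or.inl ⟨P, hP, rfl⟩)), Or.inl rfl⟩
    · rcases hz hq with rfl | ⟨P, hP, rfl | rfl⟩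
      · exact Or.inl rfl
      · exact Or.inr ⟨_, Or.inr (Or.inr (Or.inr ⟨P, hP, rfl⟩)), Or.inl rfl⟩
      · exact Or.inr ⟨_, Or.inr (Or.inr (Or.inr ⟨P, hP, rfl⟩)), Or.inr rfl⟩

theorem xBits_zPath (T : TernaryTree (Fin n)) : xBits T.zPath = 0 := by
  induction T with
  | leaf => rfl
  | node v x y z hx hy hz =>
    rw [zPath, xBits_update, hz]
    exact Function.update_eq_self v 0

theorem xBits_pathPairs {T : TernaryTree (Fin n)}
    {P : (Fin n → Pauli) × (Fin n → Pauli)} (hP : P ∈ T.pathPairs) :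
    xBits P.2 = xBits P.1 := by
  induction T generalizing P with
  | leaf => simp [pathPairs] at hP
  | node v x y z hx hy hz =>
    simp only [pathPairs, List.mem_append, List.mem_cons, List.mem_map, List.mem_reverse] at hP
    rcases hP with ⟨Q, hQ, rfl⟩ | rfl | ⟨Q, hQ, rfl⟩ | ⟨Q, hQ, rfl⟩
    · simp only [xBits_update, hx hQ]
    · simp only [xBits_update, xBits_zPath]; rfl
    · simp only [xBits_update, hy hQ]
    · simp only [xBits_update, hz hQ]

theorem bitPairing_congr_right (p : Fin n → Pauli) {q q' : Fin n → Pauli}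
    (h : xBits q = xBits q') : bitPairing p q = bitPairing p q' := by
  rw [bitPairing, bitPairing, h]

theorem bitPairing_zPath_right (p : Fin n → Pauli) (T : TernaryTree (Fin n)) :
    bitPairing p T.zPath = 0 := by
  rw [bitPairing, xBits_zPath, dotProduct_zero]

/-- Paths into disjoint subtrees share only the vertex where they branch, so its two letters alone
decide the pairing. -/
theorem bitPairing_update_of_disjoint {S T : TernaryTree (Fin n)} {v : Fin n}
    (h : S.labels.Disjoint T.labels) (hS : v ∉ S.labels) {p q : Fin n → Pauli}
    (hp : p ∈ S.pathStrings) (hq : q ∈ T.pathStrings) (P Q : Pauli) :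
    bitPairing (Function.update p v P) (Function.update q v Q) = P.zBit * Q.xBit := by
  rw [bitPairing_update (eq_I_of_mem_pathStrings hp hS), bitPairing_eq_zero, add_zero]
  intro i
  by_cases hi : i ∈ S.labels
  · exact Or.inr (eq_I_of_mem_pathStrings hq (h hi))
  · exact Or.inl (eq_I_of_mem_pathStrings hp hi)

/-- The relation between two pairs of path strings which holds if the first one belongs to an
earlier fermionic mode than the second one. -/
structure Precedes (P Q : (Fin n → Pauli) × (Fin n → Pauli)) : Prop where
  fst_fst : bitPairing P.1 Q.1 = 0
  fst_fst' : bitPairing Q.1 P.1 = 1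
  snd_fst : bitPairing P.2 Q.1 = 0
  snd_fst' : bitPairing Q.2 P.1 = 1

/-- The relations of the path strings of a tree that make its pairs into the operators of a
fermion-qubit mapping. -/
structure PathPairing (T : TernaryTree (Fin n)) : Prop where
  pairwise : T.pathPairs.Pairwise Precedes
  fst_self : ∀ P ∈ T.pathPairs, bitPairing P.1 P.1 = 0
  snd_self : ∀ P ∈ T.pathPairs, bitPairing P.2 P.1 = 1
  zPath : ∀ P ∈ T.pathPairs, bitPairing T.zPath P.1 = 1

/-- Pairs from different subtrees are ordered by the letters `X`, `Y`, `Z` at the root. The pair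
straddling `X` and `Y` comes from the all-`Z` paths of these subtrees. Such a path pairs to 1 with
every first string of its subtree, so the straddling pair follows the `X` pairs; since the edge `Y`
turns this 1 into 0, it precedes the `Y` pairs. -/
theorem pathPairing (T : TernaryTree (Fin n)) (hT : T.labels.Nodup) : PathPairing T := by
  induction T with
  | leaf => constructor <;> simp [pathPairs]
  | node v x y z hx hy hz =>
    have h2 : (1 : ZMod 2) + 1 = 0 := by decide
    simp only [labels, List.nodup_cons, List.nodup_append', List.mem_append, not_or] at hT
    obtain ⟨⟨⟨vx, vy⟩, vz⟩, ⟨nx, ny, dxy⟩, nz, dxyz⟩ := hT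
    have dxz : x.labels.Disjoint z.labels := fun i hi hi' =>
      dxyz (List.mem_append_left _ hi) hi'
    have dyz : y.labels.Disjoint z.labels := fun i hi hi' =>
      dxyz (List.mem_append_right _ hi) hi'
    specialize hx nx; specialize hy ny; specialize hz nz
    have mx {P} := mem_pathStrings_of_mem_pathPairs (T := x) (P := P)
    have my {P} := mem_pathStrings_of_mem_pathPairs (T := y) (P := P)
    have mz {P} := mem_pathStrings_of_mem_pathPairs (T := z) (P := P)
    have zx := x.zPath_mem_pathStrings
    have zy := y.zPath_mem_pathStrings
    have zz := z.zPath_mem_pathStrings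
    have ux {p} (hp : p ∈ x.pathStrings) q (Q R : Pauli) :=
      bitPairing_update (q := q) (eq_I_of_mem_pathStrings hp vx) Q R
    have uy {p} (hp : p ∈ y.pathStrings) q (Q R : Pauli) :=
      bitPairing_update (q := q) (eq_I_of_mem_pathStrings hp vy) Q R
    have uz {p} (hp : p ∈ z.pathStrings) q (Q R : Pauli) :=
      bitPairing_update (q := q) (eq_I_of_mem_pathStrings hp vz) Q R
    have uxy {p q} (hp : p ∈ x.pathStrings) (hq : q ∈ y.pathStrings) (Q R : Pauli) :=
      bitPairing_update_of_disjoint dxy vx hp hq Q R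
    have uyx {p q} (hp : p ∈ y.pathStrings) (hq : q ∈ x.pathStrings) (Q R : Pauli) :=
      bitPairing_update_of_disjoint dxy.symm vy hp hq Q R
    have uxz {p q} (hp : p ∈ x.pathStrings) (hq : q ∈ z.pathStrings) (Q R : Pauli) :=
      bitPairing_update_of_disjoint dxz vx hp hq Q R
    have uzx {p q} (hp : p ∈ z.pathStrings) (hq : q ∈ x.pathStrings) (Q R : Pauli) :=
      bitPairing_update_of_disjoint dxz.symm vz hp hq Q R
    have uyz {p q} (hp : p ∈ y.pathStrings) (hq : q ∈ z.pathStrings) (Q R : Pauli) :=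
      bitPairing_update_of_disjoint dyz vy hp hq Q R
    have uzy {p q} (hp : p ∈ z.pathStrings) (hq : q ∈ y.pathStrings) (Q R : Pauli) :=
      bitPairing_update_of_disjoint dyz.symm vz hp hq Q R
    -- The swap in the `Y` subtree puts second strings in the right argument, where only flips
    -- matter and both strings of a pair agree.
    have cy {P} (hP : P ∈ y.pathPairs) p : bitPairing p P.2 = bitPairing p P.1 :=
      bitPairing_congr_right p (xBits_pathPairs hP)
    constructor
    · simp only [pathPairs, List.pairwise_append, List.pairwise_cons, List.pairwise_map,
        List.pairwise_reverse, List.mem_append, List.mem_cons, List.mem_map, List.mem_reverse]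
      refine ⟨?_, ⟨?_, ?_, ?_, ?_⟩, ?_⟩
      · refine hx.pairwise.imp_of_mem fun {P Q} hP hQ h => ?_
        constructor <;>
          simp [ux, mx hP, mx hQ, h.fst_fst, h.fst_fst', h.snd_fst, h.snd_fst', Pauli.zBit]
      · rintro _ (⟨P, hP, rfl⟩ | ⟨P, hP, rfl⟩)
        · constructor <;>
            simp [uxy, uyx, uy, my hP, zx, zy, cy hP, hy.zPath P hP, Pauli.zBit, Pauli.xBit, h2]
        · constructor <;>
            simp [uxz, uzx, uyz, mz hP, zx, zy, Pauli.zBit, Pauli.xBit]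
      · refine hy.pairwise.imp_of_mem fun {P Q} hP hQ h => ?_
        constructor <;>
          simp [uy, my hP, my hQ, cy hP, cy hQ, h.fst_fst, h.fst_fst', h.snd_fst, h.snd_fst',
            Pauli.zBit, Pauli.xBit, h2]
      · refine hz.pairwise.imp_of_mem fun {P Q} hP hQ h => ?_
        constructor <;>
          simp [uz, mz hP, mz hQ, h.fst_fst, h.fst_fst', h.snd_fst, h.snd_fst', Pauli.xBit]
      · rintro _ ⟨P, hP, rfl⟩ _ ⟨Q, hQ, rfl⟩
        constructor <;> simp [uyz, uzy, my hP, mz hQ, Pauli.zBit, Pauli.xBit]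
      · rintro _ ⟨P, hP, rfl⟩ _ (rfl | ⟨Q, hQ, rfl⟩ | ⟨Q, hQ, rfl⟩)
        · constructor <;>
            simp [ux, uyx, mx hP, zx, zy, hx.zPath P hP, bitPairing_zPath_right, Pauli.zBit,
              Pauli.xBit]
        · constructor <;> simp [uxy, uyx, mx hP, my hQ, Pauli.zBit, Pauli.xBit]
        · constructor <;> simp [uxz, uzx, mx hP, mz hQ, Pauli.zBit, Pauli.xBit]
    all_goals
      intro P hP
      simp only [pathPairs, List.mem_append, List.mem_cons, List.mem_map, List.mem_reverse] at hP
      rcases hP with ⟨Q, hQ, rfl⟩ | rfl | ⟨Q, hQ, rfl⟩ | ⟨Q, hQ, rfl⟩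
    · simp [ux, mx hQ, hx.fst_self Q hQ, Pauli.zBit]
    · simp [ux, zx, bitPairing_zPath_right, Pauli.zBit]
    · simp [uy, my hQ, cy hQ, hy.snd_self Q hQ, Pauli.zBit, Pauli.xBit, h2]
    · simp [uz, mz hQ, hz.fst_self Q hQ, Pauli.xBit]
    · simp [ux, mx hQ, hx.snd_self Q hQ, Pauli.zBit]
    · simp [uyx, zx, zy, Pauli.zBit, Pauli.xBit]
    · simp [uy, my hQ, cy hQ, hy.fst_self Q hQ, Pauli.zBit, Pauli.xBit]
    · simp [uz, mz hQ, hz.snd_self Q hQ, Pauli.xBit]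
    · simp [TernaryTree.zPath, uzx, mx hQ, zz, Pauli.zBit, Pauli.xBit]
    · simp [TernaryTree.zPath, uzx, zx, zz, Pauli.zBit, Pauli.xBit]
    · simp [TernaryTree.zPath, uzy, my hQ, zz, Pauli.zBit, Pauli.xBit]
    · simp [TernaryTree.zPath, uz, zz, hz.zPath Q hQ, Pauli.xBit]

/-! ### Existence and uniqueness of the matrix `G` for a tree. -/

theorem IsLabelled.length_pathPairs {T : TernaryTree (Fin n)} (hT : T.IsLabelled) :
    T.pathPairs.length = n := by
  rw [T.length_pathPairs, ← List.toFinset_card_of_nodup hT.1,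
    Finset.eq_univ_of_forall fun i => List.mem_toFinset.mpr (hT.2 i), Finset.card_fin]

/-- The self-pairing of `p` is the parity of its number of `Y`s, so `c` agrees with `i ^ yCount p`
up to sign. -/
theorem smul_xzOp_mem_paulis {T : TernaryTree (Fin n)} {p : Fin n → Pauli}
    (hp : p ∈ T.pathStrings) {c : ℂ} (hc : c = Complex.I ^ (bitPairing p p).val) :
    c • xzOp (xBits p) (zBits p) ∈ T.paulis ∨ -(c • xzOp (xBits p) (zBits p)) ∈ T.paulis := by
  have key : pauliString p = Complex.I ^ (2 * (yCount p / 2)) • c • xzOp (xBits p) (zBits p) := by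
    have hv : (bitPairing p p).val = yCount p % 2 := by
      rw [bitPairing, ← yCount_cast, ZMod.val_natCast]
    rw [pauliString_eq, smul_smul, hc, ← pow_add, hv, Nat.div_add_mod]
  have hm : pauliString p ∈ T.paulis := ⟨p, hp, rfl⟩
  rw [key, pow_mul, Complex.I_sq] at hm
  rcases neg_one_pow_eq_or ℂ (yCount p / 2) with h | h <;> rw [h] at hm
  · left; simpa using hm
  · right; simpa using hm

theorem bits_of_xzOp_mem_paulis {T : TernaryTree (Fin n)} {a b : Fin n → ZMod 2}
    (h : xzOp a b ∈ T.paulis ∨ -xzOp a b ∈ T.paulis) :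
    ∃ p ∈ T.pathStrings, xBits p = a ∧ zBits p = b := by
  rcases h with ⟨p, hp, h⟩ | ⟨p, hp, h⟩
  · rw [pauliString_eq] at h
    obtain ⟨ha, hb⟩ := xzOp_eq_smul_xzOp h.symm
    exact ⟨p, hp, ha.symm, hb.symm⟩
  · rw [pauliString_eq, eq_neg_iff_add_eq_zero, add_comm, ← eq_neg_iff_add_eq_zero,
      ← neg_smul] at h
    obtain ⟨ha, hb⟩ := xzOp_eq_smul_xzOp h
    exact ⟨p, hp, ha.symm, hb.symm⟩

theorem exists_isTreeBased {T : TernaryTree (Fin n)} (hT : T.IsLabelled) :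
    ∃ G : GL (Fin n) (ZMod 2), IsTreeBased T (conjJW (linOp G)) := by
  have hl := hT.length_pathPairs
  have hT' := T.pathPairing hT.1
  set P : Fin n → (Fin n → Pauli) × (Fin n → Pauli) := fun i => T.pathPairs.get (i.cast hl.symm)
    with hP
  have hmem : ∀ i, P i ∈ T.pathPairs := fun i => List.get_mem _ _
  have hpre : ∀ i j, i < j → Precedes (P i) (P j) := fun i j hij =>
    List.pairwise_iff_get.mp hT'.pairwise _ _ hij
  have h1 : ∀ i j, bitPairing (P i).1 (P j).1 = if j < i then 1 else 0 := by
    intro i j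
    rcases lt_trichotomy i j with h | rfl | h
    · rw [if_neg h.not_gt, (hpre i j h).fst_fst]
    · rw [if_neg (lt_irrefl _), hT'.fst_self _ (hmem i)]
    · rw [if_pos h, (hpre j i h).fst_fst']
  have h2 : ∀ i j, bitPairing (P i).2 (P j).1 = (if j < i then 1 else 0) + if j = i then 1 else 0 := by
    intro i j
    rcases lt_trichotomy i j with h | rfl | h
    · rw [if_neg h.not_gt, if_neg h.ne', (hpre i j h).snd_fst, add_zero]
    · rw [if_neg (lt_irrefl _), if_pos rfl, hT'.snd_self _ (hmem i), zero_add]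
    · rw [if_pos h, if_neg h.ne, (hpre j i h).snd_fst', add_zero]
  let A : Matrix (Fin n) (Fin n) (ZMod 2) := Matrix.of fun k j => xBits (P j).1 k
  -- The signs of the two Jordan-Wigner operators of mode `i` differ by the `i`-th unit vector,
  -- which conjugation turns into row `i` of the inverse of `G`.
  let B : Matrix (Fin n) (Fin n) (ZMod 2) := Matrix.of fun i k => zBits (P i).2 k - zBits (P i).1 k
  have hBA : B * A = 1 := by
    ext i j
    have e : (B * A) i j = bitPairing (P i).2 (P j).1 - bitPairing (P i).1 (P j).1 := by
      rw [bitPairing, bitPairing, ← sub_dotProduct]; rfl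
    rw [e, h1, h2, add_sub_cancel_left, Matrix.one_apply]
    simp only [eq_comm]
  let G : GL (Fin n) (ZMod 2) := ⟨A, B, mul_eq_one_comm.mp hBA, hBA⟩
  have ha : ∀ i, G.val.mulVec (Pi.single i 1) = xBits (P i).1 := by
    intro i
    rw [Matrix.mulVec_single_one]; rfl
  have hinv : ∀ b z : Fin n → ZMod 2, Matrix.vecMul z G.val = b →
      Matrix.vecMul b (G⁻¹).val = z := by
    rintro _ z rfl
    rw [Matrix.vecMul_vecMul, Units.mul_inv, Matrix.vecMul_one]
  have hb1 : ∀ i, Matrix.vecMul (before i) (G⁻¹).val = zBits (P i).1 := by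
    intro i
    refine hinv _ _ (funext fun j => ?_)
    exact h1 i j
  have hb2 : ∀ i, Matrix.vecMul (before i + Pi.single i 1) (G⁻¹).val = zBits (P i).2 := by
    intro i
    refine hinv _ _ (funext fun j => ?_)
    refine (h2 i j).trans ?_
    simp [before, Pi.single_apply]
  refine ⟨G, ⟨_, linOp_mem_unitaryGroup G, rfl⟩, fun i => ?_⟩
  obtain ⟨m1, m2⟩ := mem_pathStrings_of_mem_pathPairs (hmem i)
  rw [conjJW_linOp, ha, hb1, hb2]
  constructor
  · simpa using smul_xzOp_mem_paulis m1 (c := 1) (by rw [hT'.fst_self _ (hmem i)]; simp)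
  · rw [← xBits_pathPairs (hmem i)]
    refine smul_xzOp_mem_paulis m2 ?_
    rw [bitPairing_congr_right _ (xBits_pathPairs (hmem i)), hT'.snd_self _ (hmem i),
      ZMod.val_one, pow_one]

/-- The even operators must be the first strings of the pairs, and the pairing fixes their order;
hence the columns of `G` are determined by `T`. -/
theorem exists_ofFn_eq_of_isTreeBased {T : TernaryTree (Fin n)} (hT : T.IsLabelled)
    {G : GL (Fin n) (ZMod 2)} (hG : IsTreeBased T (conjJW (linOp G))) :
    ∃ p : Fin n → Fin n → Pauli, List.ofFn p = T.pathPairs.map Prod.fst ∧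
      ∀ i, xBits (p i) = G.val.mulVec (Pi.single i 1) := by
  have hT' := T.pathPairing hT.1
  have hp : ∀ i, ∃ p ∈ T.pathStrings, xBits p = G.val.mulVec (Pi.single i 1) ∧
      zBits p = Matrix.vecMul (before i) (G⁻¹).val := fun i =>
    bits_of_xzOp_mem_paulis (by simpa only [conjJW_linOp] using (hG.2 i).1)
  choose p hmem hx hz using hp
  refine ⟨p, ?_, hx⟩
  have hpair : ∀ i j, bitPairing (p i) (p j) = if j < i then 1 else 0 := by
    intro i j
    rw [bitPairing, hx, hz, ← Matrix.dotProduct_mulVec, inv_mulVec_mulVec,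
      dotProduct_single, mul_one]
    rfl
  have hsub : List.ofFn p ⊆ T.pathPairs.map Prod.fst := by
    intro q hq
    obtain ⟨i, rfl⟩ := List.mem_ofFn.mp hq
    -- The all-`Z` path has no flips, but a column of `G` is nonzero. A second string has
    -- self-pairing 1, but an even operator has 0.
    rcases eq_of_mem_pathStrings (hmem i) with h | ⟨P, hP, h | h⟩
    · exfalso
      have h0 := hx i
      rw [h, xBits_zPath] at h0
      have := inv_mulVec_mulVec G (Pi.single i 1)
      rw [← h0, Matrix.mulVec_zero] at this
      simpa using congrFun this i
    · exact List.mem_map.mpr ⟨P, hP, h.symm⟩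
    · exfalso
      have h0 := hpair i i
      rw [if_neg (lt_irrefl i), h, bitPairing_congr_right _ (xBits_pathPairs hP),
        hT'.snd_self P hP] at h0
      exact one_ne_zero h0
  have hinj : Function.Injective p := by
    intro i j hij
    by_contra hne
    rcases lt_or_gt_of_ne hne with h | h
    · have h1 := hpair j i
      have h2 := hpair i i
      rw [if_pos h] at h1
      rw [if_neg (lt_irrefl i), hij, ← hij] at h2
      rw [← hij, h2] at h1
      exact zero_ne_one h1
    · have h1 := hpair i j
      have h2 := hpair i i
      rw [if_pos h, ← hij] at h1
      rw [if_neg (lt_irrefl i), h1] at h2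
      exact one_ne_zero h2
  have hperm : (List.ofFn p).Perm (T.pathPairs.map Prod.fst) := by
    refine (List.subperm_of_subset (List.nodup_ofFn.mpr hinj) hsub).perm_of_length_le ?_
    rw [List.length_map, List.length_ofFn, hT.length_pathPairs]
  have hsorted : (T.pathPairs.map Prod.fst).Pairwise fun q r => bitPairing q r = 0 :=
    List.pairwise_map.mpr (hT'.pairwise.imp fun h => h.fst_fst)
  -- Vanishing of the pairing is antisymmetric on these strings, and both lists are sorted by it, so
  -- the permutation is an equality.
  refine hperm.eq_of_pairwise (le := fun q r => bitPairing q r = 0) ?_ ?_ hsorted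
  · intro q r hq hr hqr hrq
    obtain ⟨i, rfl⟩ := List.mem_ofFn.mp hq
    obtain ⟨j, rfl⟩ := List.mem_ofFn.mp (hperm.mem_iff.mpr hr)
    rw [hpair] at hqr hrq
    have h1 : ¬ j < i := fun h => by rw [if_pos h] at hqr; exact one_ne_zero hqr
    have h2 : ¬ i < j := fun h => by rw [if_pos h] at hrq; exact one_ne_zero hrq
    rw [le_antisymm (not_lt.mp h1) (not_lt.mp h2)]
  · rw [List.pairwise_ofFn]
    intro i j hij
    rw [hpair, if_neg hij.not_gt]

theorem eq_of_isTreeBased {T : TernaryTree (Fin n)} (hT : T.IsLabelled)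
    {G G' : GL (Fin n) (ZMod 2)} (hG : IsTreeBased T (conjJW (linOp G)))
    (hG' : IsTreeBased T (conjJW (linOp G'))) : G = G' := by
  obtain ⟨p, hp, hx⟩ := exists_ofFn_eq_of_isTreeBased hT hG
  obtain ⟨p', hp', hx'⟩ := exists_ofFn_eq_of_isTreeBased hT hG'
  obtain rfl : p = p' := List.ofFn_injective (hp.trans hp'.symm)
  exact Units.ext (Matrix.ext_of_mulVec_single fun i => by rw [← hx, ← hx'])

end TernaryTree

theorem mainTheorem2 (n : ℕ) (T : TernaryTree (Fin n)) (hT : T.IsLabelled) :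
    (∃! C : QubitOp n, C ∈ cliffordGroup n ∧
      (∀ f, C.mulVec (ket f) = fockState (conjJW C) (ket 0) f) ∧
      IsTreeBased T (conjJW C) ∧ IsClassicalEncoding (conjJW C) (ket 0)) ∧
    (∀ C ∈ cliffordGroup n, ∀ C' ∈ cliffordGroup n,
      IsTreeBased T (conjJW C) → IsClassicalEncoding (conjJW C) (ket 0) →
      IsTreeBased T (conjJW C') → IsClassicalEncoding (conjJW C') (ket 0) →
      conjJW C' = conjJW C ∧ ∃ u : ℂ, ‖u‖ = 1 ∧ C' = u • C) ∧
    (∀ C ∈ cliffordGroup n,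
      IsClassicalEncoding (conjJW C) (ket 0) → IsLinearEncoding (conjJW C) (ket 0)) := by
  refine ⟨?_, ?_, ?_⟩
  · obtain ⟨G, hG⟩ := TernaryTree.exists_isTreeBased hT
    refine ⟨linOp G, ⟨linOp_mem_cliffordGroup G, fun f => ?_, hG,
      isClassicalEncoding_conjJW_linOp G⟩, ?_⟩
    · rw [linOp_mulVec_ket, fockState_conjJW_linOp]
    · rintro C ⟨hC, hfock, htree, hclass⟩
      obtain ⟨G', u, hu, hCG, hf⟩ := exists_eq_smul_linOp hC hclass
      rw [hCG, conjJW_smul hu] at htree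
      rw [TernaryTree.eq_of_isTreeBased hT hG htree]
      -- The normalization identifies `C|f⟩` with a Fock state, which carries no phase; this
      -- eliminates `u`.
      exact ext_ket fun f => by rw [hfock, hf, linOp_mulVec_ket]
  · intro C hC C' hC' htree hclass htree' hclass'
    obtain ⟨G, u, hu, rfl, -⟩ := exists_eq_smul_linOp hC hclass
    obtain ⟨G', u', hu', rfl, -⟩ := exists_eq_smul_linOp hC' hclass'
    rw [conjJW_smul hu] at htree
    rw [conjJW_smul hu'] at htree'
    obtain rfl := TernaryTree.eq_of_isTreeBased hT htree htree'
    have hu0 : u ≠ 0 := fun h0 => by simp [h0] at hu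
    refine ⟨by rw [conjJW_smul hu, conjJW_smul hu'], u' * u⁻¹, by simp [hu, hu'], ?_⟩
    rw [smul_smul, mul_assoc, inv_mul_cancel₀ hu0, mul_one]
  · intro C hC hclass
    obtain ⟨G, -, -, -, hf⟩ := exists_eq_smul_linOp hC hclass
    exact ⟨hclass.1, hclass.2.1, G, hf⟩
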